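/- **Definitions.** For $n\in\mathbb N=\{0,1,2,\dots\}$ let $\sigma_n=2^V$ be the abstract simplex on an $n$-element vertex set $V$ (so $\sigma_0=\{\varnothing\}$). A pointed face of a finite simplicial complex $\Delta$ is a pair $(F,v)$ with $F\in\Delta$ and $v\in F$. The antiprism triangulation $\mathrm{sd}_{\mathcal A}(\Delta)$ is the clique complex of the graph on the pointed faces of $\Delta$ in which two distinct pointed faces $(F,v)$ and $(F',v')$ are adjacent if $F=F'$, or $F\subsetneq F'$ and $v'\in F'\setminus F$, or $F'\subsetneq F$ and $v\in F\setminus F'$. The $h$-polynomial of a $(d-1)$-dimensional simplicial complex $\Delta$ is $h(\Delta,x)=\sum_{F\in\Delta}x^{|F|}(1-x)^{d-|F|}$, and $h_{\mathcal A}(\sigma_n,x):=h(\mathrm{sd}_{\mathcal A}(\sigma_n),x)$. A polynomial $p(x)\in\mathbb R[x]$ is real-rooted if $p=0$ or all its complex roots are real. A nonzero real-rooted polynomial with roots $\alpha_1\ge\alpha_2\ge\cdots$ (listed with multiplicity) interlaces a nonzero real-rooted polynomial with roots $\beta_1\ge\beta_2\ge\cdots$ if $\cdots\le\alpha_2\le\beta_2\le\alpha_1\le\beta_1$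 (so the second polynomial has as many roots as the first or exactly one more); by convention the zero polynomial interlaces, and is interlaced by, every real-rooted polynomial. Every $p(x)\in\mathbb R[x]$ of degree at most $m$ can be written uniquely as $p(x)=a(x)+x\,b(x)$ with $a(x)=x^m a(1/x)$ and $b(x)=x^{m-1}b(1/x)$ ($b=0$ if $m=0$), where $\deg a\le m$ and $\deg b\le m-1$; this is the symmetric decomposition of $p$ with respect to $m$. It is nonnegative if $a$ and $b$ have nonnegative coefficients, real-rooted if $a$ and $b$ are real-rooted, and real-rooted and interlacing if $a$ and $b$ are real-rooted and $x^m p(1/x)$ interlaces $p(x)$. **Theorem.** For every $n\in\mathbb N$, the polynomial $h_{\mathcal A}(\sigma_n,x)$ is real-rooted and interlaces $h_{\mathcal A}(\sigma_{n+1},x)$. Moreover, for every positive integer $n$, the polynomial $h_{\mathcal A}(\sigma_n,x)$ has a nonnegative, real-rooted and interlacing symmetric decomposition with respect to $n-1$. -/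

import Mathlib

namespace Antiprism

open Polynomial

noncomputable section

/-! ### Simplicial complexes

A simplicial complex on the vertex set `V` is a Mathlib `AbstractSimplicialComplex V`; its `faces`
are the nonempty faces, and the empty face is always added by hand below. -/

/-- The set of all faces of `Δ`, including the empty one, as a finset. -/
def allFaces {V : Type*} [Fintype V] (Δ : AbstractSimplicialComplex V) : Finset (Finset V) :=
  open Classical in Finset.univ.filter fun F => F = ∅ ∨ F ∈ Δ.faces

/-- The maximal cardinality of a face of `Δ`, that is, `dim Δ + 1`. -/
def rank {V : Type*} [Fintype V] (Δ : AbstractSimplicialComplex V) : ℕ :=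
  (allFaces Δ).sup Finset.card

/-- The `h`-polynomial `h(Δ, x) = ∑_{F ∈ Δ} x^|F| (1 - x)^(d - |F|)`, where `d = dim Δ + 1`. -/
def hPoly {V : Type*} [Fintype V] (Δ : AbstractSimplicialComplex V) : ℝ[X] :=
  ∑ F ∈ allFaces Δ, X ^ F.card * (1 - X) ^ (rank Δ - F.card)

/-- The clique complex of a graph: its faces are the sets of pairwise adjacent vertices. -/
def cliqueComplex {V : Type*} (G : SimpleGraph V) : AbstractSimplicialComplex V where
  faces := {s | s.Nonempty ∧ G.IsClique (s : Set V)}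
  isRelLowerSet_faces := fun _ hs =>
    ⟨hs.1, fun _ hts ht => ⟨ht, hs.2.subset (Finset.coe_subset.2 hts)⟩⟩
  singleton_mem v := ⟨Finset.singleton_nonempty v, by simp⟩

/-- The simplex `σ_n`: every nonempty subset of an `n`-element set is a (nonempty) face. -/
abbrev simplex (n : ℕ) : AbstractSimplicialComplex (Fin n) := ⊤

/-! ### The antiprism triangulation -/

/-- Pointed faces `(F, v)` of `Δ`: a face `F` with a chosen vertex `v ∈ F`. -/
abbrev PointedFace {V : Type*} (Δ : AbstractSimplicialComplex V) : Type _ :=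
  {p : Finset V × V // p.1 ∈ Δ.faces ∧ p.2 ∈ p.1}

instance {V : Type*} [Fintype V] (Δ : AbstractSimplicialComplex V) : Fintype (PointedFace Δ) :=
  Fintype.ofFinite _

/-- The graph on the pointed faces of `Δ` in which two distinct pointed faces `(F, v)` and
`(F', v')` are adjacent if `F = F'`, or `F ⊂ F'` and `v' ∈ F' \ F`, or `F' ⊂ F` and
`v ∈ F \ F'`. -/
def pointedFaceGraph {V : Type*} (Δ : AbstractSimplicialComplex V) :
    SimpleGraph (PointedFace Δ) where
  Adj p q := p ≠ q ∧ (p.1.1 = q.1.1 ∨ (p.1.1 ⊂ q.1.1 ∧ q.1.2 ∉ p.1.1) ∨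
    (q.1.1 ⊂ p.1.1 ∧ p.1.2 ∉ q.1.1))
  symm := ⟨fun _ _ h => ⟨h.1.symm, h.2.elim (fun h => Or.inl h.symm) fun h => Or.inr h.symm⟩⟩
  loopless := ⟨fun _ h => h.1 rfl⟩

/-- The antiprism triangulation `sd_A(Δ)`. -/
def antiprismTriangulation {V : Type*} (Δ : AbstractSimplicialComplex V) :
    AbstractSimplicialComplex (PointedFace Δ) :=
  cliqueComplex (pointedFaceGraph Δ)

/-- `h_A(σ_n, x)`, the `h`-polynomial of the antiprism triangulation of the simplex `σ_n`. -/
def hA (n : ℕ) : ℝ[X] := hPoly (antiprismTriangulation (simplex n))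

/-! ### Real-rootedness, interlacing and symmetric decompositions -/

/-- `p` is zero or all complex roots of `p` are real. -/
def RealRooted (p : ℝ[X]) : Prop :=
  p = 0 ∨ ∀ z : ℂ, aeval z p = 0 → z.im = 0

/-- The real roots of `p` with multiplicity, in weakly decreasing order. -/
def rootList (p : ℝ[X]) : List ℝ := p.roots.sort (· ≥ ·)

/-- `p` interlaces `q`: both are real-rooted, and either one of them is zero, or their roots
`α₁ ≥ α₂ ≥ ⋯` and `β₁ ≥ β₂ ≥ ⋯` (with multiplicity) alternate as
`⋯ ≤ α₂ ≤ β₂ ≤ α₁ ≤ β₁`; in particular `q` has as many roots as `p` or one more. -/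
def Interlaces (p q : ℝ[X]) : Prop :=
  RealRooted p ∧ RealRooted q ∧
    (p = 0 ∨ q = 0 ∨
      ((rootList p).length ≤ (rootList q).length ∧
        (rootList q).length ≤ (rootList p).length + 1 ∧
        (∀ (i : ℕ) (hp : i < (rootList p).length) (hq : i < (rootList q).length),
          (rootList p)[i] ≤ (rootList q)[i]) ∧
        (∀ (i : ℕ) (hp : i < (rootList p).length) (hq : i + 1 < (rootList q).length),
          (rootList q)[i + 1] ≤ (rootList p)[i])))

/-- `p` is symmetric with center of symmetry `c / 2`: `a_i = a_{c-i}` for all integers `i`, where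
the coefficients with negative index are zero. For `c = -1` this forces `p = 0`. -/
def IsSymmetric (c : ℤ) (p : ℝ[X]) : Prop :=
  (∀ i j : ℕ, (i : ℤ) + j = c → p.coeff i = p.coeff j) ∧ ∀ i : ℕ, c < i → p.coeff i = 0

/-- `p = a + x b` is the symmetric decomposition of `p` with respect to `n`. -/
def IsSymmetricDecomposition (n : ℕ) (p a b : ℝ[X]) : Prop :=
  p = a + X * b ∧ IsSymmetric n a ∧ IsSymmetric ((n : ℤ) - 1) b

/-- `p` (of degree at most `n`) has a nonnegative, real-rooted and interlacing symmetric
decomposition `p = a + x b` with respect to `n`: both `a` and `b` have nonnegative coefficients and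
are real-rooted, and `x^n p(1/x)` interlaces `p`. -/
def HasNonnegRealRootedInterlacingSymmetricDecomposition (n : ℕ) (p : ℝ[X]) : Prop :=
  p.natDegree ≤ n ∧
  (∃ a b : ℝ[X], IsSymmetricDecomposition n p a b ∧
    (∀ i, 0 ≤ a.coeff i) ∧ (∀ i, 0 ≤ b.coeff i) ∧ RealRooted a ∧ RealRooted b) ∧
  Interlaces (p.reflect n) p

end

end Antiprism

-- Write `h_n` for `h_A(σ_n, x)`. The proof places `h_n` at the head of the `n`th row `L_0, …, L_n,
-- R_n, …, R_0` of a recursively defined array. For `z` in the upper half plane, the values along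
-- each row have weakly increasing arguments, spread over at most `arg z`. The recursion preserves
-- this (`ArgSorted.step`), since each new entry is a sum of old entries, some multiplied by `z`.
-- The two middle entries agree, and comparing them makes the needed inequalities strict. A
-- Hermite–Biehler argument (`interlaces_of_cross_pos`) turns strict argument inequalities into
-- interlacing of real roots.
--
-- The `R` half consists of the reversals of the `L` half (`exists_decomposition_row`), so a sum of
-- `R` entries comes with its symmetric decomposition `a + x b`. If `a` or `b` vanished at some `z`
-- above the real axis, two values with strictly different arguments would be parallel.
--
-- The array is tied to the triangulation by a recurrence. Removing the largest set of a nonempty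
-- clique of pointed faces gives a recurrence for the face enumerator (`cliqueSum_recurrence`). The
-- heads of the rows satisfy the same one: for the linear functional `E` with `E(t^n) = L_0` of row
-- `n`, the array relations become `E(g(t) + g(t+x-1) - g(t+x)) = g(0)`.

namespace Antiprism
open Polynomial Filter Topology

-- Hermite–Biehler criterion for interlacing

/-- The oriented area spanned by two complex numbers. -/
def cross (u v : ℂ) : ℝ := u.re * v.im - u.im * v.re

theorem realRooted_of_ne_zero {p : ℝ[X]} (h : ∀ z : ℂ, 0 < z.im → aeval z p ≠ 0) :
    RealRooted p := by
  refine Or.inr fun z hz => ?_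
  rcases lt_trichotomy z.im 0 with h0 | h0 | h0
  · refine absurd ?_ (h ((starRingEnd ℂ) z) (by simpa using h0))
    rw [aeval_conj, hz, map_zero]
  · exact h0
  · exact absurd hz (h z h0)

theorem RealRooted.splits {p : ℝ[X]} (h : RealRooted p) : p.Splits := by
  rcases h with rfl | h
  · simp
  by_cases hp : p = 0
  · simp [hp]
  refine Splits.of_splits_map (algebraMap ℝ ℂ) (IsAlgClosed.splits _) fun z hz => ?_
  have h1 : aeval z p = 0 := by
    rw [mem_roots (by simpa using hp), IsRoot.def, eval_map_algebraMap] at hz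
    exact hz
  exact ⟨z.re, Complex.ext (by simp) (by simp [h z h1])⟩

/-- The sum of the arguments of `z - α` over the elements `α` of a multiset of real numbers. -/
noncomputable def argSum (s : Multiset ℝ) (z : ℂ) : ℝ :=
  (s.map fun α : ℝ => (z - α).arg).sum

theorem argSum_cons (a : ℝ) (s : Multiset ℝ) (z : ℂ) :
    argSum (a ::ₘ s) z = (z - a).arg + argSum s z := by
  simp [argSum]

theorem exists_prod_eq_mul_exp_argSum (s : Multiset ℝ) {z : ℂ} (hz : 0 < z.im) :
    ∃ c : ℝ, 0 < c ∧
      (s.map fun α : ℝ => z - (α : ℂ)).prod = c * Complex.exp (argSum s z * Complex.I) := by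
  induction s using Multiset.induction with
  | empty => exact ⟨1, one_pos, by simp [argSum]⟩
  | cons a s ih =>
    obtain ⟨c, hc, h⟩ := ih
    have hne : z - a ≠ 0 := fun h0 => by
      have := congrArg Complex.im h0
      simp at this
      exact hz.ne' this
    refine ⟨‖z - a‖ * c, mul_pos (norm_pos_iff.2 hne) hc, ?_⟩
    rw [Multiset.map_cons, Multiset.prod_cons, h, argSum_cons]
    nth_rewrite 1 [← Complex.norm_mul_exp_arg_mul_I (z - a)]
    push_cast
    rw [add_mul, Complex.exp_add]
    ring

theorem exists_aeval_eq_mul_exp_argSum {p : ℝ[X]} (hp : p.Splits) (hl : 0 < p.leadingCoeff)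
    {z : ℂ} (hz : 0 < z.im) :
    ∃ c : ℝ, 0 < c ∧ aeval z p = c * Complex.exp (argSum p.roots z * Complex.I) := by
  obtain ⟨c, hc, h⟩ := exists_prod_eq_mul_exp_argSum p.roots hz
  refine ⟨p.leadingCoeff * c, mul_pos hl hc, ?_⟩
  nth_rewrite 1 [hp.eq_prod_roots]
  rw [map_mul, aeval_C, map_multiset_prod, Multiset.map_map]
  simp only [Function.comp_def, map_sub, aeval_X, aeval_C]
  simp only [Complex.coe_algebraMap]
  rw [h]
  push_cast
  ring

theorem cross_mul_exp (a b s t : ℝ) :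
    cross (a * Complex.exp (s * Complex.I)) (b * Complex.exp (t * Complex.I)) =
      a * b * Real.sin (t - s) := by
  simp only [cross, Complex.exp_mul_I, ← Complex.ofReal_cos, ← Complex.ofReal_sin,
    Complex.mul_re, Complex.mul_im, Complex.add_re, Complex.add_im, Complex.ofReal_re,
    Complex.ofReal_im, Complex.I_re, Complex.I_im, Real.sin_sub]
  ring

theorem continuous_argSum (s : Multiset ℝ) {ε : ℝ} (hε : 0 < ε) :
    Continuous fun t : ℝ => argSum s (t + ε * Complex.I) := by
  unfold argSum
  refine continuous_multiset_sum _ fun a _ => ?_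
  refine continuous_iff_continuousAt.2 fun t => ?_
  refine ContinuousAt.comp (g := Complex.arg) (Complex.continuousAt_arg ?_) (by fun_prop)
  exact Or.inr (by simpa using hε.ne')

theorem tendsto_argSum_atTop (s : Multiset ℝ) (ε : ℝ) :
    Tendsto (fun t : ℝ => argSum s (t + ε * Complex.I)) atTop (𝓝 0) := by
  induction s using Multiset.induction with
  | empty => simp [argSum]
  | cons a s ih =>
    simp only [argSum_cons]
    have h1 : Tendsto (fun t : ℝ => ((t : ℂ) + ε * Complex.I - a).arg) atTop (𝓝 0) := by
      have h2 : Tendsto (fun t : ℝ => (ε / (t - a) : ℝ)) atTop (𝓝 0) :=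
        Tendsto.div_atTop tendsto_const_nhds (tendsto_atTop_add_const_right _ _ tendsto_id)
      have h3 : Tendsto (fun t : ℝ => ((1 : ℂ) + (ε / (t - a) : ℝ) * Complex.I).arg) atTop
          (𝓝 (Complex.arg (1 + (0 : ℝ) * Complex.I))) := by
        refine (Complex.continuousAt_arg (by simp)).tendsto.comp ?_
        exact tendsto_const_nhds.add (((Complex.continuous_ofReal.tendsto _).comp h2).mul_const _)
      simp only [Complex.ofReal_zero, zero_mul, add_zero, Complex.arg_one] at h3
      refine h3.congr' ?_
      filter_upwards [eventually_gt_atTop a] with t ht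
      rw [← Complex.arg_real_mul _ (sub_pos.2 ht)]
      congr 1
      have : ((t : ℂ) - a) ≠ 0 := by exact_mod_cast (sub_pos.2 ht).ne'
      push_cast
      field_simp
      ring
    simpa using h1.add ih

/-- As the point descends to `t`, a root to the right of `t` contributes `π` and a root to the left
contributes `0`, so arguments count roots. -/
theorem tendsto_argSum_nhdsGT_zero (s : Multiset ℝ) {t : ℝ} (ht : t ∉ s) :
    Tendsto (fun ε : ℝ => argSum s (t + ε * Complex.I)) (𝓝[>] 0)
      (𝓝 (Real.pi * s.countP (t < ·))) := by
  induction s using Multiset.induction with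
  | empty => simp [argSum]
  | cons a s ih =>
    simp only [argSum_cons]
    rw [Multiset.mem_cons, not_or] at ht
    have h0 : Tendsto (fun ε : ℝ => (t : ℂ) + ε * Complex.I - a) (𝓝[>] 0) (𝓝 ((t : ℂ) - a)) := by
      have : Continuous fun ε : ℝ => (t : ℂ) + ε * Complex.I - a := by fun_prop
      simpa using (this.tendsto 0).mono_left nhdsWithin_le_nhds
    rcases lt_or_gt_of_ne ht.1 with h | h
    · rw [Multiset.countP_cons_of_pos _ h]
      have h1 : Tendsto (fun ε : ℝ => ((t : ℂ) + ε * Complex.I - a).arg) (𝓝[>] 0)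
          (𝓝 Real.pi) := by
        refine (Complex.tendsto_arg_nhdsWithin_im_nonneg_of_re_neg_of_im_zero
          (z := (t : ℂ) - a) (by simpa using h) (by simp)).comp ?_
        refine tendsto_nhdsWithin_iff.2 ⟨h0, ?_⟩
        filter_upwards [self_mem_nhdsWithin] with ε hε
        simpa using le_of_lt hε
      convert h1.add (ih ht.2) using 2
      push_cast
      ring
    · rw [Multiset.countP_cons_of_neg _ (not_lt.2 h.le)]
      have h1 : Tendsto (fun ε : ℝ => ((t : ℂ) + ε * Complex.I - a).arg) (𝓝[>] 0)
          (𝓝 0) := by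
        have h2 : Complex.arg ((t : ℂ) - a) = 0 := by
          rw [← Complex.ofReal_sub, Complex.arg_ofReal_of_nonneg (sub_nonneg.2 h.le)]
        have h3 := (Complex.continuousAt_arg (x := (t : ℂ) - a)
          (Or.inl (by simpa using h))).tendsto.comp h0
        rwa [h2] at h3
      simpa using h1.add (ih ht.2)

/-- On a horizontal line the difference is continuous and tends to `0` at `+∞`. Its sine never
vanishes, so it cannot cross `0` or `π`, and positivity of the sine selects the interval `(0, π)`.
-/
theorem argSum_sub_mem_Ioo {r s : Multiset ℝ}
    (h : ∀ z : ℂ, 0 < z.im → 0 < Real.sin (argSum s z - argSum r z)) (t : ℝ) {ε : ℝ}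
    (hε : 0 < ε) :
    argSum s (t + ε * Complex.I) - argSum r (t + ε * Complex.I) ∈ Set.Ioo 0 Real.pi := by
  set φ : ℝ → ℝ := fun t => argSum s (t + ε * Complex.I) - argSum r (t + ε * Complex.I)
  have hc : Continuous φ := (continuous_argSum s hε).sub (continuous_argSum r hε)
  have hs : ∀ t, 0 < Real.sin (φ t) := fun t => h _ (by simpa using hε)
  have hl : Tendsto φ atTop (𝓝 0) := by
    simpa using (tendsto_argSum_atTop s ε).sub (tendsto_argSum_atTop r ε)
  obtain ⟨T, hT⟩ := (hl.eventually (Ioo_mem_nhds (neg_lt_zero.2 Real.pi_pos) Real.pi_pos)).exists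
  have hT0 : 0 < φ T := by
    by_contra! hn
    exact (hs T).not_ge (Real.sin_nonpos_of_nonpos_of_neg_pi_le hn hT.1.le)
  have key : ∀ c, (φ T < c → φ t < c ∨ ∃ t', φ t' = c) ∧ (c < φ T → c < φ t ∨ ∃ t', φ t' = c) := by
    intro c
    constructor
    · intro h1
      by_contra! h2
      obtain ⟨x, hx⟩ := mem_range_of_exists_le_of_exists_ge hc ⟨T, h1.le⟩ ⟨t, h2.1⟩
      exact h2.2 x hx
    · intro h1
      by_contra! h2
      obtain ⟨x, hx⟩ := mem_range_of_exists_le_of_exists_ge hc ⟨t, h2.1⟩ ⟨T, h1.le⟩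
      exact h2.2 x hx
  constructor
  · rcases (key 0).2 hT0 with h1 | ⟨x, hx⟩
    · exact h1
    · have := hs x
      simp [hx] at this
  · rcases (key Real.pi).1 hT.2 with h1 | ⟨x, hx⟩
    · exact h1
    · have := hs x
      simp [hx] at this

/-- The argument difference stays in `(0, π)` down to the real axis, where its limit is `π` times
the difference of the two counts. -/
theorem countP_le_of_sin_pos {r s : Multiset ℝ}
    (h : ∀ z : ℂ, 0 < z.im → 0 < Real.sin (argSum s z - argSum r z)) {t : ℝ}
    (hr : t ∉ r) (hs : t ∉ s) :
    r.countP (t < ·) ≤ s.countP (t < ·) ∧ s.countP (t < ·) ≤ r.countP (t < ·) + 1 := by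
  have hl := (tendsto_argSum_nhdsGT_zero s hs).sub (tendsto_argSum_nhdsGT_zero r hr)
  have h0 : ∀ᶠ ε : ℝ in 𝓝[>] 0, argSum s (t + ε * Complex.I) - argSum r (t + ε * Complex.I) ∈
      Set.Ioo 0 Real.pi := by
    filter_upwards [self_mem_nhdsWithin] with ε hε using argSum_sub_mem_Ioo h t hε
  have h1 := ge_of_tendsto hl (h0.mono fun ε h => h.1.le)
  have h2 := le_of_tendsto hl (h0.mono fun ε h => h.2.le)
  rw [← mul_sub] at h1 h2
  have h3 := nonneg_of_mul_nonneg_right h1 Real.pi_pos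
  have h4 := le_of_mul_le_mul_left (h2.trans_eq (mul_one _).symm) Real.pi_pos
  constructor
  · exact_mod_cast sub_nonneg.1 h3
  · rw [sub_le_iff_le_add'] at h4
    exact_mod_cast h4

theorem rootList_antitone (p : ℝ[X]) {i j : ℕ} (hij : i ≤ j) (hj : j < (rootList p).length) :
    (rootList p)[j] ≤ (rootList p)[i] := by
  have : (rootList p).Pairwise (· ≥ ·) := Multiset.pairwise_sort _ _
  exact this.rel_get_of_le (a := ⟨i, hij.trans_lt hj⟩) (b := ⟨j, hj⟩) hij

theorem lt_countP_of_lt_getElem (p : ℝ[X]) {i : ℕ} (hi : i < (rootList p).length) {t : ℝ}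
    (h : t < (rootList p)[i]) : i < p.roots.countP (t < ·) := by
  have h1 : p.roots.countP (t < ·) = (rootList p).countP (t < ·) := by
    rw [← Multiset.coe_countP, rootList, Multiset.sort_eq]
  rw [h1]
  calc i < ((rootList p).take (i + 1)).length := by
        rw [List.length_take]; omega
    _ = ((rootList p).take (i + 1)).countP (t < ·) := by
        refine (List.countP_eq_length.2 fun a ha => ?_).symm
        obtain ⟨k, hk, rfl⟩ := List.mem_iff_getElem.1 ha
        rw [List.length_take] at hk
        rw [List.getElem_take]
        simpa using h.trans_le (rootList_antitone p (by omega) hi)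
    _ ≤ _ := (List.take_sublist _ _).countP_le

theorem countP_le_of_getElem_lt (p : ℝ[X]) {i : ℕ} (hi : i < (rootList p).length) {t : ℝ}
    (h : (rootList p)[i] < t) : p.roots.countP (t < ·) ≤ i := by
  have h1 : p.roots.countP (t < ·) = (rootList p).countP (t < ·) := by
    rw [← Multiset.coe_countP, rootList, Multiset.sort_eq]
  rw [h1]
  nth_rewrite 1 [← List.take_append_drop i (rootList p)]
  have h2 : ((rootList p).drop i).countP (t < ·) = 0 := by
    refine List.countP_eq_zero.2 fun a ha => ?_
    obtain ⟨k, hk, rfl⟩ := List.mem_iff_getElem.1 ha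
    rw [List.getElem_drop]
    rw [List.length_drop] at hk
    simpa using ((rootList_antitone p (Nat.le_add_right i k) (by omega)).trans h.le)
  rw [List.countP_append, h2, add_zero]
  exact List.countP_le_length.trans (by rw [List.length_take]; omega)

theorem exists_notMem_Ioo (r s : Multiset ℝ) {a b : ℝ} (hab : a < b) :
    ∃ t, a < t ∧ t < b ∧ t ∉ r ∧ t ∉ s := by
  classical
  obtain ⟨t, ht, hn⟩ := (Set.Ioo_infinite hab).exists_notMem_finset (r + s).toFinset
  simp only [Multiset.mem_toFinset, Multiset.mem_add, not_or] at hn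
  exact ⟨t, ht.1, ht.2, hn⟩

theorem exists_countP_eq_card (r s : Multiset ℝ) :
    ∃ t, t ∉ r ∧ t ∉ s ∧ r.countP (t < ·) = r.card ∧ s.countP (t < ·) = s.card := by
  classical
  obtain ⟨b, hb⟩ := (r + s).toFinset.bddBelow
  have h : ∀ a ∈ r + s, b - 1 < a := fun a ha =>
    (sub_one_lt b).trans_le (hb (by simpa using ha))
  refine ⟨b - 1, fun h1 => (h _ (Multiset.mem_add.2 (Or.inl h1))).false,
    fun h1 => (h _ (Multiset.mem_add.2 (Or.inr h1))).false,
    Multiset.countP_eq_card.2 fun a ha => h a (Multiset.mem_add.2 (Or.inl ha)),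
    Multiset.countP_eq_card.2 fun a ha => h a (Multiset.mem_add.2 (Or.inr ha))⟩

/-- A Hermite–Biehler type criterion: two real polynomials with positive leading coefficients
interlace if the argument increases from `p z` to `q z` for `z` in the upper half plane. -/
theorem interlaces_of_cross_pos {p q : ℝ[X]} (hp : 0 < p.leadingCoeff) (hq : 0 < q.leadingCoeff)
    (h : ∀ z : ℂ, 0 < z.im → 0 < cross (aeval z p) (aeval z q)) : Interlaces p q := by
  have hpr : RealRooted p := realRooted_of_ne_zero fun z hz h0 => by
    simpa [h0, cross] using h z hz
  have hqr : RealRooted q := realRooted_of_ne_zero fun z hz h0 => by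
    simpa [h0, cross] using h z hz
  have hsin : ∀ z : ℂ, 0 < z.im → 0 < Real.sin (argSum q.roots z - argSum p.roots z) := by
    intro z hz
    obtain ⟨c, hc, h1⟩ := exists_aeval_eq_mul_exp_argSum hpr.splits hp hz
    obtain ⟨d, hd, h2⟩ := exists_aeval_eq_mul_exp_argSum hqr.splits hq hz
    have h3 := h z hz
    rw [h1, h2, cross_mul_exp] at h3
    exact pos_of_mul_pos_right h3 (mul_pos hc hd).le
  have hcount := fun t => countP_le_of_sin_pos (t := t) hsin
  have hlen : ∀ p : ℝ[X], (rootList p).length = p.roots.card := fun p => Multiset.length_sort ..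
  refine ⟨hpr, hqr, Or.inr (Or.inr ?_)⟩
  -- A point below all roots compares the total numbers of roots.
  obtain ⟨t, h1, h2, h3, h4⟩ := exists_countP_eq_card p.roots q.roots
  have h5 := hcount t h1 h2
  rw [h3, h4] at h5
  refine ⟨by rw [hlen, hlen]; exact h5.1, by rw [hlen, hlen]; exact h5.2, ?_, ?_⟩
  · intro i hi hj
    by_contra! hlt
    -- A violated inequality leaves a gap; counting roots above a point in the gap contradicts
    -- `hcount`.
    obtain ⟨t, ht1, ht2, h1, h2⟩ := exists_notMem_Ioo p.roots q.roots hlt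
    have h3 := lt_countP_of_lt_getElem p hi ht2
    have h4 := countP_le_of_getElem_lt q hj ht1
    have := (hcount t h1 h2).1
    omega
  · intro i hi hj
    by_contra! hlt
    obtain ⟨t, ht1, ht2, h1, h2⟩ := exists_notMem_Ioo p.roots q.roots hlt
    have h3 := countP_le_of_getElem_lt p hi ht1
    have h4 := lt_countP_of_lt_getElem q hj ht2
    have := (hcount t h1 h2).2
    omega

end Antiprism
-- The array of polynomials and its arguments in the upper half plane
namespace Antiprism
open Polynomial Finset

theorem cross_sum_sum {ι κ : Type*} (s : Finset ι) (t : Finset κ) (f : ι → ℂ) (g : κ → ℂ) :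
    cross (∑ i ∈ s, f i) (∑ j ∈ t, g j) = ∑ i ∈ s, ∑ j ∈ t, cross (f i) (g j) := by
  simp only [cross, Complex.re_sum, Complex.im_sum, Finset.sum_mul_sum, ← Finset.sum_sub_distrib]

theorem cross_sum_nonneg {ι κ : Type*} {s : Finset ι} {t : Finset κ} {f : ι → ℂ} {g : κ → ℂ}
    (h : ∀ i ∈ s, ∀ j ∈ t, 0 ≤ cross (f i) (g j)) :
    0 ≤ cross (∑ i ∈ s, f i) (∑ j ∈ t, g j) := by
  rw [cross_sum_sum]
  exact sum_nonneg fun i hi => sum_nonneg fun j hj => h i hi j hj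

theorem cross_le_cross_sum {ι κ : Type*} {s : Finset ι} {t : Finset κ} {f : ι → ℂ} {g : κ → ℂ}
    (h : ∀ i ∈ s, ∀ j ∈ t, 0 ≤ cross (f i) (g j)) {i : ι} (hi : i ∈ s) {j : κ} (hj : j ∈ t) :
    cross (f i) (g j) ≤ cross (∑ i ∈ s, f i) (∑ j ∈ t, g j) := by
  rw [cross_sum_sum]
  refine (single_le_sum (f := fun j => cross (f i) (g j)) (fun j hj => h i hi j hj) hj).trans ?_
  exact single_le_sum (f := fun i => ∑ j ∈ t, cross (f i) (g j))
    (fun i hi => sum_nonneg fun j hj => h i hi j hj) hi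

theorem cross_self_mul (z u : ℂ) : cross u (z * u) = z.im * Complex.normSq u := by
  simp only [cross, Complex.mul_re, Complex.mul_im, Complex.normSq_apply]
  ring

theorem cross_mul_mul (z u v : ℂ) : cross (z * u) (z * v) = Complex.normSq z * cross u v := by
  simp only [cross, Complex.mul_re, Complex.mul_im, Complex.normSq_apply]
  ring

theorem cross_add_left (u v w : ℂ) : cross (u + v) w = cross u w + cross v w := by
  simp only [cross, Complex.add_re, Complex.add_im]
  ring

theorem cross_add_right (u v w : ℂ) : cross u (v + w) = cross u v + cross u w := by
  simp only [cross, Complex.add_re, Complex.add_im]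
  ring

theorem cross_swap (u v : ℂ) : cross u v = -cross v u := by
  simp only [cross]
  ring

theorem cross_self (u : ℂ) : cross u u = 0 := by
  simp only [cross]
  ring

/-- The complex numbers `b 0, …, b n, a n, …, a 0` are listed by increasing argument, within a
range of length at most the argument of `z`. -/
structure ArgSorted (z : ℂ) (n : ℕ) (b a : ℕ → ℂ) : Prop where
  bb : ∀ i j, i ≤ j → j ≤ n → 0 ≤ cross (b i) (b j)
  zbb : ∀ i j, i ≤ j → j ≤ n → 0 ≤ cross (b j) (z * b i)
  ba : ∀ i j, i ≤ n → j ≤ n → 0 ≤ cross (b i) (a j)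
  zba : ∀ i j, i ≤ n → j ≤ n → 0 ≤ cross (a j) (z * b i)
  aa : ∀ i j, i ≤ j → j ≤ n → 0 ≤ cross (a j) (a i)
  zaa : ∀ i j, i ≤ j → j ≤ n → 0 ≤ cross (a i) (z * a j)

theorem sum_range_add_sum_Ico {M : Type*} [AddCommMonoid M] (f : ℕ → M) {m k : ℕ} (h : m ≤ k) :
    ∑ j ∈ range k, f j = ∑ j ∈ range m, f j + ∑ j ∈ Ico m k, f j := by
  rw [range_eq_Ico, range_eq_Ico, sum_Ico_consecutive _ (Nat.zero_le m) h]

/-- Splitting each full sum at the index of the partial sum and expanding bilinearly leaves only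
nonnegative terms: parts common to both sides cancel or give `cross u (z * u) ≥ 0`, and a common
factor `z` only scales by `|z|²`. -/
theorem ArgSorted.step {z : ℂ} (hz : 0 ≤ z.im) {n : ℕ} {b a : ℕ → ℂ} (h : ArgSorted z n b a) :
    ArgSorted z (n + 1) (fun m => ∑ j ∈ range (n + 1), a j + z * ∑ j ∈ range m, b j)
      (fun m => z * ∑ j ∈ range (n + 1), b j + ∑ j ∈ range m, a j) := by
  have hN := Complex.normSq_nonneg z
  have hself : ∀ u, 0 ≤ cross u (z * u) := fun u => by
    rw [cross_self_mul]
    exact mul_nonneg hz (Complex.normSq_nonneg u)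
  have hbb : ∀ {i j k : ℕ}, i ≤ j → k ≤ n + 1 →
      0 ≤ cross (∑ l ∈ range i, b l) (∑ l ∈ Ico j k, b l) := fun hij hk =>
    cross_sum_nonneg fun i hi j hj => h.bb i j (by simp at hi hj; omega) (by simp at hj; omega)
  have hzbb : ∀ {i j k : ℕ}, i ≤ j → k ≤ n + 1 →
      0 ≤ cross (∑ l ∈ Ico j k, b l) (z * ∑ l ∈ range i, b l) := fun hij hk => by
    rw [mul_sum]
    exact cross_sum_nonneg fun j hj i hi =>
      h.zbb i j (by simp at hi hj; omega) (by simp at hj; omega)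
  have haa : ∀ {i j k : ℕ}, i ≤ j → k ≤ n + 1 →
      0 ≤ cross (∑ l ∈ Ico j k, a l) (∑ l ∈ range i, a l) := fun hij hk =>
    cross_sum_nonneg fun j hj i hi => h.aa i j (by simp at hi hj; omega) (by simp at hj; omega)
  have hzaa : ∀ {i j k : ℕ}, i ≤ j → k ≤ n + 1 →
      0 ≤ cross (∑ l ∈ range i, a l) (z * ∑ l ∈ Ico j k, a l) := fun hij hk => by
    rw [mul_sum]
    exact cross_sum_nonneg fun i hi j hj =>
      h.zaa i j (by simp at hi hj; omega) (by simp at hj; omega)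
  have hba : ∀ {s t : Finset ℕ}, (∀ i ∈ s, i ≤ n) → (∀ i ∈ t, i ≤ n) →
      0 ≤ cross (∑ l ∈ s, b l) (∑ l ∈ t, a l) := fun hs ht =>
    cross_sum_nonneg fun i hi j hj => h.ba i j (hs i hi) (ht j hj)
  have hzba : ∀ {s t : Finset ℕ}, (∀ i ∈ s, i ≤ n) → (∀ i ∈ t, i ≤ n) →
      0 ≤ cross (∑ l ∈ t, a l) (z * ∑ l ∈ s, b l) := fun hs ht => by
    rw [mul_sum]
    exact cross_sum_nonneg fun j hj i hi => h.zba i j (hs i hi) (ht j hj)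
  have hI : ∀ {j k : ℕ}, k ≤ n + 1 → ∀ i ∈ Ico j k, i ≤ n := fun hk i hi => by
    simp at hi; omega
  have hR : ∀ {k : ℕ}, k ≤ n + 1 → ∀ i ∈ range k, i ≤ n := fun hk i hi => by
    simp at hi; omega
  constructor
  · intro i j hij hj
    have h1 := hbb (le_refl i) hj
    have h2 := hzba (hI (j := i) hj) (hR (le_refl (n + 1)))
    rw [sum_range_add_sum_Ico b hij, mul_add, ← add_assoc, cross_add_right, cross_self,
      cross_add_left, cross_mul_mul]
    linarith [mul_nonneg hN h1]
  · intro i j hij hj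
    have h1 := hzbb (le_refl i) hj
    have h2 := hba (hI (j := i) hj) (hR (le_refl (n + 1)))
    rw [sum_range_add_sum_Ico b hij, mul_add, ← add_assoc, cross_add_left, cross_mul_mul,
      cross_add_right]
    linarith [mul_nonneg hN h1, mul_nonneg hN h2,
      hself (∑ j ∈ range (n + 1), a j + z * ∑ j ∈ range i, b j)]
  · intro i j hi hj
    have h1 := hzba (hI (j := i) (le_refl (n + 1))) (hR hj)
    have h2 := hzba (hR (le_refl (n + 1))) (hI (j := j) (le_refl (n + 1)))
    have h3 := haa (le_refl j) (le_refl (n + 1))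
    have h4 := hbb (le_refl i) (le_refl (n + 1))
    rw [sum_range_add_sum_Ico b hi] at h2 ⊢
    rw [sum_range_add_sum_Ico a hj]
    set P := ∑ l ∈ Ico j (n + 1), a l
    set Q := ∑ l ∈ range j, a l
    set P' := ∑ l ∈ Ico i (n + 1), b l
    set Q' := ∑ l ∈ range i, b l
    have key : cross (Q + P + z * Q') (z * (Q' + P') + Q) = cross P (z * (Q' + P')) +
        cross Q (z * P') + cross P Q + Complex.normSq z * cross Q' P' := by
      simp only [cross_add_left, cross_add_right, mul_add, ← cross_mul_mul, cross_self]
      rw [cross_swap (z * Q') Q]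
      ring
    rw [key]
    linarith [mul_nonneg hN h4]
  · intro i j hi hj
    have h1 := hba (hR hi) (hI (j := j) (le_refl (n + 1)))
    have h2 := hba (hI (j := i) (le_refl (n + 1))) (hR hj)
    have h3 := hba (hI (j := i) (le_refl (n + 1))) (hI (j := j) (le_refl (n + 1)))
    have h4 := hzbb (le_refl i) (le_refl (n + 1))
    have h5 := hzaa (le_refl j) (le_refl (n + 1))
    rw [sum_range_add_sum_Ico b hi, sum_range_add_sum_Ico a hj]
    set P := ∑ l ∈ Ico j (n + 1), a l
    set Q := ∑ l ∈ range j, a l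
    set P' := ∑ l ∈ Ico i (n + 1), b l
    set Q' := ∑ l ∈ range i, b l
    -- The common part is `Q + z * Q'`: the first argument exceeds it by `z * P'`, the second
    -- exceeds `z` times it by `z * P`.
    have key : cross (z * (Q' + P') + Q) (z * (Q + P + z * Q')) =
        cross (Q + z * Q') (z * (Q + z * Q')) + Complex.normSq z * cross Q' P +
        Complex.normSq z * cross P' Q + Complex.normSq z * cross P' P +
        Complex.normSq z * cross P' (z * Q') + cross Q (z * P) := by
      simp only [cross_add_left, cross_add_right, mul_add, ← cross_mul_mul]
      ring
    rw [key]
    linarith [mul_nonneg hN h1, mul_nonneg hN h2, mul_nonneg hN h3, mul_nonneg hN h4,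
      hself (Q + z * Q')]
  · intro i j hij hj
    have h1 := haa (le_refl i) hj
    have h2 := hzba (hR (le_refl (n + 1))) (hI (j := i) hj)
    rw [sum_range_add_sum_Ico a hij, ← add_assoc, cross_add_left, cross_self, cross_add_right]
    linarith
  · intro i j hij hj
    have h1 := hzaa (le_refl i) hj
    have h2 := hba (hR (le_refl (n + 1))) (hI (j := i) hj)
    rw [sum_range_add_sum_Ico a hij, ← add_assoc, mul_add z (_ + _), cross_add_right,
      cross_add_left _ _ (z * ∑ l ∈ Ico i j, a l), cross_mul_mul]
    linarith [mul_nonneg hN h2, hself (z * ∑ j ∈ range (n + 1), b j + ∑ j ∈ range i, a j)]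

mutual
/-- The first half of the `n`th row of an interlacing array starting with `h_A(σ_n, x)`. -/
noncomputable def rowL : ℕ → ℕ → ℝ[X]
  | 0, _ => 1
  | n + 1, m => ∑ j ∈ range (n + 1), rowR n j + X * ∑ j ∈ range m, rowL n j

/-- The second half, in reverse order, of the `n`th row of the array. -/
noncomputable def rowR : ℕ → ℕ → ℝ[X]
  | 0, _ => 1
  | n + 1, m => X * ∑ j ∈ range (n + 1), rowL n j + ∑ j ∈ range m, rowR n j
end

theorem rowL_succ_zero (n : ℕ) : rowL (n + 1) 0 = ∑ j ∈ range (n + 1), rowR n j := by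
  rw [rowL, range_zero, sum_empty, mul_zero, add_zero]

theorem rowR_succ_zero (n : ℕ) : rowR (n + 1) 0 = X * ∑ j ∈ range (n + 1), rowL n j := by
  rw [rowR, range_zero, sum_empty, add_zero]

theorem rowR_succ_self (n : ℕ) : rowR (n + 1) (n + 1) = rowL (n + 1) 0 + rowR (n + 1) 0 := by
  rw [rowL_succ_zero, rowR_succ_zero, rowR, add_comm]

theorem rowL_self (n : ℕ) : rowL n n = rowR n n := by
  cases n with
  | zero => rw [rowL, rowR]
  | succ n => rw [rowL, rowR, add_comm]

theorem argSorted_row {z : ℂ} (hz : 0 ≤ z.im) (n : ℕ) :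
    ArgSorted z n (fun m => aeval z (rowL n m)) (fun m => aeval z (rowR n m)) := by
  induction n with
  | zero =>
    constructor <;> simp [rowL, rowR, cross, hz]
  | succ n ih =>
    convert ih.step hz using 2 with m m
    · simp [rowL]
    · simp [rowR]

/-- Sortedness alone gives only `≥ 0`. Strictness comes from one term of the double sum: the common
middle entry `u` of the previous row contributes `cross u (z * u)`, positive once `u ≠ 0`. -/
theorem cross_rowL_rowR_pos {z : ℂ} (hz : 0 < z.im) (n : ℕ) :
    0 < cross (aeval z (rowL (n + 1) 0)) (aeval z (rowR (n + 1) 0)) := by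
  induction n with
  | zero => simpa [rowL, rowR, cross] using hz
  | succ n ih =>
    -- The middle entry is the sum of the two end entries; were it zero, these would be parallel,
    -- against the induction hypothesis.
    have hne : aeval z (rowR (n + 1) (n + 1)) ≠ 0 := fun h0 => by
      rw [rowR_succ_self, map_add] at h0
      have := cross_add_right (aeval z (rowL (n + 1) 0)) (aeval z (rowL (n + 1) 0))
        (aeval z (rowR (n + 1) 0))
      rw [h0, cross_self, zero_add] at this
      rw [← this] at ih
      simp [cross] at ih
    rw [rowL_succ_zero (n + 1), rowR_succ_zero (n + 1), map_mul, map_sum, map_sum, aeval_X,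
      mul_sum]
    have hs := argSorted_row hz.le (n + 1)
    have hmem : n + 1 ∈ range (n + 1 + 1) := by simp
    refine lt_of_lt_of_le ?_ (cross_le_cross_sum (fun i hi j hj => hs.zba j i
      (by simp at hj; omega) (by simp at hi; omega)) hmem hmem)
    rw [rowL_self, cross_self_mul]
    exact mul_pos hz (Complex.normSq_pos.2 hne)

theorem cross_rowR_mul_rowL_pos {z : ℂ} (hz : 0 < z.im) (n : ℕ) :
    0 < cross (aeval z (rowR (n + 2) 0)) (z * aeval z (rowL (n + 2) 0)) := by
  rw [rowL_succ_zero (n + 1), rowR_succ_zero (n + 1), map_mul, map_sum, map_sum, aeval_X,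
    cross_mul_mul]
  have hs := argSorted_row hz.le (n + 1)
  have hmem : 0 ∈ range (n + 1 + 1) := by simp
  refine mul_pos (Complex.normSq_pos.2 fun h => by simp [h] at hz) ?_
  exact (cross_rowL_rowR_pos hz n).trans_le (cross_le_cross_sum (fun i hi j hj => hs.ba i j
      (by simp at hi; omega) (by simp at hj; omega)) hmem hmem)

theorem cross_rowL_rowL_succ_pos {z : ℂ} (hz : 0 < z.im) (n : ℕ) :
    0 < cross (aeval z (rowL (n + 1) 0)) (aeval z (rowL (n + 2) 0)) := by
  rw [rowL_succ_zero (n + 1), map_sum]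
  have hs := argSorted_row hz.le (n + 1)
  have h0 := cross_le_cross_sum (s := {0}) (t := range (n + 1 + 1)) (i := 0) (j := 0)
    (fun i hi j hj => hs.ba i j (by simp at hi; omega) (by simp at hj; omega))
    (by simp) (by simp)
  rw [sum_singleton] at h0
  exact (cross_rowL_rowR_pos hz n).trans_le h0

end Antiprism
-- Symmetric decompositions of the rows
namespace Antiprism
open Polynomial Finset

theorem IsSymmetric.zero (c : ℤ) : IsSymmetric c 0 := by simp [IsSymmetric]

theorem IsSymmetric.add {c : ℤ} {p q : ℝ[X]} (hp : IsSymmetric c p) (hq : IsSymmetric c q) :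
    IsSymmetric c (p + q) :=
  ⟨fun i j h => by rw [coeff_add, coeff_add, hp.1 i j h, hq.1 i j h],
    fun i h => by rw [coeff_add, hp.2 i h, hq.2 i h, add_zero]⟩

theorem IsSymmetric.sum {ι : Type*} {c : ℤ} {s : Finset ι} {f : ι → ℝ[X]}
    (h : ∀ i ∈ s, IsSymmetric c (f i)) : IsSymmetric c (∑ i ∈ s, f i) :=
  sum_induction f (IsSymmetric c) (fun _ _ => IsSymmetric.add) (IsSymmetric.zero c) h

theorem IsSymmetric.X_mul {c : ℤ} {p : ℝ[X]} (hp : IsSymmetric c p) :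
    IsSymmetric (c + 2) (X * p) := by
  have h : ∀ i : ℕ, c + 2 ≤ i → (X * p).coeff i = 0 := fun i hi => by
    cases i with
    | zero => simp
    | succ i => rw [coeff_X_mul]; exact hp.2 i (by push_cast at hi; omega)
  refine ⟨fun i j hij => ?_, fun i hi => h i hi.le⟩
  cases i with
  | zero => rw [h j (by push_cast at hij; omega), coeff_X_mul_zero]
  | succ i =>
    cases j with
    | zero => rw [h (i + 1) (by push_cast at hij ⊢; omega), coeff_X_mul_zero]
    | succ j =>
      rw [coeff_X_mul, coeff_X_mul]
      exact hp.1 i j (by push_cast at hij; omega)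

theorem IsSymmetric.one_add_X_mul {c : ℤ} {p : ℝ[X]} (hp : IsSymmetric c p) :
    IsSymmetric (c + 1) ((1 + X) * p) := by
  rw [add_mul, one_mul]
  constructor
  · intro i j hij
    cases i with
    | zero =>
      cases j with
      | zero => rfl
      | succ j =>
        rw [coeff_add, coeff_add, coeff_X_mul_zero, coeff_X_mul,
          hp.2 (j + 1) (by push_cast at hij ⊢; omega), hp.1 0 j (by push_cast at hij ⊢; omega)]
        ring
    | succ i =>
      cases j with
      | zero =>
        rw [coeff_add, coeff_add, coeff_X_mul_zero, coeff_X_mul,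
          hp.2 (i + 1) (by push_cast at hij ⊢; omega), hp.1 0 i (by push_cast at hij ⊢; omega)]
        ring
      | succ j =>
        rw [coeff_add, coeff_add, coeff_X_mul, coeff_X_mul,
          hp.1 i (j + 1) (by push_cast at hij ⊢; omega),
          hp.1 (i + 1) j (by push_cast at hij ⊢; omega)]
        ring
  · intro i hi
    cases i with
    | zero => rw [coeff_add, coeff_X_mul_zero, hp.2 0 (by omega), add_zero]
    | succ i =>
      rw [coeff_add, coeff_X_mul, hp.2 (i + 1) (by omega), hp.2 i (by push_cast at hi; omega),
        add_zero]

theorem IsSymmetric.eq_zero {c : ℤ} {p : ℝ[X]} (hp : IsSymmetric c p) (hc : c < 0) : p = 0 :=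
  ext fun i => hp.2 i (by omega)

/-- All coefficients of `p` are nonnegative. -/
def NonnegCoeffs (p : ℝ[X]) : Prop := ∀ i, 0 ≤ p.coeff i

theorem NonnegCoeffs.add {p q : ℝ[X]} (hp : NonnegCoeffs p) (hq : NonnegCoeffs q) :
    NonnegCoeffs (p + q) := fun i => by
  rw [coeff_add]
  exact add_nonneg (hp i) (hq i)

theorem NonnegCoeffs.sum {ι : Type*} {s : Finset ι} {f : ι → ℝ[X]}
    (h : ∀ i ∈ s, NonnegCoeffs (f i)) : NonnegCoeffs (∑ i ∈ s, f i) := fun i => by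
  rw [finsetSum_coeff]
  exact sum_nonneg fun j hj => h j hj i

theorem NonnegCoeffs.X_mul {p : ℝ[X]} (hp : NonnegCoeffs p) : NonnegCoeffs (X * p) := fun i => by
  cases i with
  | zero => simp
  | succ i => rw [coeff_X_mul]; exact hp i

theorem NonnegCoeffs.leadingCoeff_pos {p : ℝ[X]} (hp : NonnegCoeffs p) (h0 : p ≠ 0) :
    0 < p.leadingCoeff :=
  (hp _).lt_of_ne' (leadingCoeff_ne_zero.2 h0)

/-- Reversal with respect to `n` fixes `w` and sends `u` to `X * u`, so the statement encodes that
`rowR n m` is the reversal of `rowL n m`, in a form that the recursion preserves. -/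
theorem exists_decomposition_row (n : ℕ) : ∃ u w : ℕ → ℝ[X], ∀ m ≤ n,
    (rowL n m = u m + w m ∧ rowR n m = w m + X * u m) ∧
    (NonnegCoeffs (u m) ∧ NonnegCoeffs (w m)) ∧
    IsSymmetric ((n : ℤ) - 1) (u m) ∧ IsSymmetric n (w m) := by
  induction n with
  | zero =>
    refine ⟨fun _ => 0, fun _ => 1, fun m _ => ⟨by simp [rowL, rowR], ⟨fun i => by simp, ?_⟩,
      .zero _, ?_⟩⟩
    · intro i
      rw [coeff_one]
      split_ifs <;> norm_num
    · refine ⟨fun i j h => ?_, fun i hi => ?_⟩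
      · rw [show i = j by push_cast at h; omega]
      · rw [coeff_one, if_neg (by push_cast at hi; omega)]
  | succ n ih =>
    obtain ⟨u, w, h⟩ := ih
    have hI : ∀ {m j : ℕ}, j ∈ Ico m (n + 1) → j ≤ n := fun hj => by simp at hj; omega
    have hR : ∀ {m j : ℕ}, m ≤ n + 1 → j ∈ range m → j ≤ n := fun hm hj => by
      simp at hj; omega
    -- For `j < m` each `w j` pairs with `X * w j` to give the symmetric `(1 + X) * w j`. The
    -- unpaired `w j` with `j ≥ m` have the symmetry required of the new `u`.
    refine ⟨fun m => ∑ j ∈ Ico m (n + 1), w j, fun m => ∑ j ∈ range m,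
      ((1 + X) * w j + (X * u j + X * u j)) + X * ∑ j ∈ Ico m (n + 1), u j,
      fun m hm => ⟨?_, ⟨?_, ?_⟩, ?_, ?_⟩⟩
    · have hL : ∀ k ≤ n + 1, ∑ j ∈ range k, rowL n j = ∑ j ∈ range k, u j + ∑ j ∈ range k, w j :=
        fun k hk => by
          rw [← sum_add_distrib]
          exact sum_congr rfl fun j hj => (h j (hR hk hj)).1.1
      have hR' : ∀ k ≤ n + 1, ∑ j ∈ range k, rowR n j =
          ∑ j ∈ range k, w j + X * ∑ j ∈ range k, u j := fun k hk => by
        rw [mul_sum, ← sum_add_distrib]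
        exact sum_congr rfl fun j hj => (h j (hR hk hj)).1.2
      have hS : ∑ j ∈ range m, ((1 + X) * w j + (X * u j + X * u j)) =
          (1 + X) * ∑ j ∈ range m, w j + 2 * X * ∑ j ∈ range m, u j := by
        rw [mul_sum, mul_sum, ← sum_add_distrib]
        exact sum_congr rfl fun j _ => by ring
      beta_reduce
      rw [rowL, rowR, hL _ le_rfl, hR' _ le_rfl, hL _ hm, hR' _ hm, hS,
        sum_range_add_sum_Ico u hm, sum_range_add_sum_Ico w hm]
      constructor <;> ring
    · exact .sum fun j hj => (h j (hI hj)).2.1.2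
    · refine .add (.sum fun j hj => .add ?_ ?_) (.X_mul (.sum fun j hj => (h j (hI hj)).2.1.1))
      · have := (h j (hR hm hj)).2.1.2
        rw [add_mul, one_mul]
        exact this.add this.X_mul
      · have := (h j (hR hm hj)).2.1.1.X_mul
        exact this.add this
    · have : ((n + 1 : ℕ) : ℤ) - 1 = n := by push_cast; ring
      rw [this]
      exact .sum fun j hj => (h j (hI hj)).2.2.2
    · have h1 : ((n + 1 : ℕ) : ℤ) = n + 1 := by push_cast; ring
      have h2 : ((n + 1 : ℕ) : ℤ) = (n : ℤ) - 1 + 2 := by push_cast; ring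
      refine .add (.sum fun j hj => .add ?_ ?_) ?_
      · rw [h1]
        exact (h j (hR hm hj)).2.2.2.one_add_X_mul
      · have := (h j (hR hm hj)).2.2.1.X_mul
        rw [h2]
        exact this.add this
      · rw [h2]
        exact .X_mul (.sum fun j hj => (h j (hI hj)).2.2.1)

theorem exists_symmetricDecomposition_rowL (n : ℕ) : ∃ a b : ℝ[X],
    IsSymmetricDecomposition n (rowL (n + 1) 0) a b ∧ rowR (n + 1) 0 = X * (a + b) ∧
    NonnegCoeffs a ∧ NonnegCoeffs b := by
  obtain ⟨u, w, h⟩ := exists_decomposition_row n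
  have hR : ∀ {j : ℕ}, j ∈ range (n + 1) → j ≤ n := fun hj => by simp at hj; omega
  refine ⟨∑ j ∈ range (n + 1), w j, ∑ j ∈ range (n + 1), u j, ⟨?_, ?_, ?_⟩, ?_, ?_, ?_⟩
  · rw [rowL_succ_zero, mul_sum, ← sum_add_distrib]
    exact sum_congr rfl fun j hj => (h j (hR hj)).1.2
  · exact .sum fun j hj => (h j (hR hj)).2.2.2
  · exact .sum fun j hj => (h j (hR hj)).2.2.1
  · rw [rowR_succ_zero, ← sum_add_distrib]
    exact congrArg _ (sum_congr rfl fun j hj => (h j (hR hj)).1.1.trans (add_comm _ _))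
  · exact .sum fun j hj => (h j (hR hj)).2.1.2
  · exact .sum fun j hj => (h j (hR hj)).2.1.1

theorem IsSymmetricDecomposition.reflect_eq {n : ℕ} {p a b : ℝ[X]}
    (h : IsSymmetricDecomposition n p a b) : p.reflect n = a + b := by
  obtain ⟨rfl, ha, hb⟩ := h
  ext i
  rw [coeff_reflect, coeff_add, coeff_add]
  rcases le_or_gt i n with hi | hi
  · rw [revAt_le hi, ha.1 (n - i) i (by omega)]
    congr 1
    rcases hi.eq_or_lt with rfl | hi
    · rw [Nat.sub_self, coeff_X_mul_zero, hb.2 i (by omega)]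
    · obtain ⟨k, rfl⟩ := Nat.exists_eq_add_of_lt hi
      rw [show i + k + 1 - i = k + 1 by omega, coeff_X_mul]
      exact hb.1 k i (by push_cast; omega)
  · rw [revAt_eq_self_of_lt hi, ha.2 i (by omega), hb.2 i (by omega)]
    obtain ⟨k, rfl⟩ := Nat.exists_eq_add_of_lt hi
    rw [coeff_X_mul, hb.2 _ (by push_cast; omega)]

theorem IsSymmetricDecomposition.natDegree_le {n : ℕ} {p a b : ℝ[X]}
    (h : IsSymmetricDecomposition n p a b) : p.natDegree ≤ n := by
  obtain ⟨rfl, ha, hb⟩ := h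
  refine natDegree_le_iff_coeff_eq_zero.2 fun i hi => ?_
  obtain ⟨k, rfl⟩ := Nat.exists_eq_add_of_lt hi
  rw [coeff_add, coeff_X_mul, ha.2 _ (by omega), hb.2 _ (by push_cast; omega), add_zero]

theorem rowL_zero_zero : rowL 0 0 = 1 := by rw [rowL]

theorem rowL_one_zero : rowL 1 0 = 1 := by
  rw [rowL_succ_zero]
  simp [rowR]

/-- Needed for the smallest cases, where both polynomials are `1`, `cross` vanishes and the strict
criterion does not apply. -/
theorem interlaces_one_one : Interlaces 1 1 := by
  have h1 : RealRooted 1 := realRooted_of_ne_zero fun z _ => by simp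
  have h2 : rootList 1 = [] := by
    rw [← List.length_eq_zero_iff, rootList, Multiset.length_sort, roots_one]
    rfl
  exact ⟨h1, h1, Or.inr (Or.inr (by simp [h2]))⟩

theorem leadingCoeff_rowL_pos (n : ℕ) : 0 < (rowL n 0).leadingCoeff := by
  cases n with
  | zero => simp [rowL_zero_zero]
  | succ n =>
    obtain ⟨a, b, h, -, ha, hb⟩ := exists_symmetricDecomposition_rowL n
    rw [h.1]
    refine (ha.add hb.X_mul).leadingCoeff_pos fun h0 => ?_
    have := cross_rowL_rowR_pos (z := Complex.I) (by simp) n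
    rw [h.1, h0] at this
    simp [cross] at this

theorem interlaces_rowL_succ (n : ℕ) : Interlaces (rowL n 0) (rowL (n + 1) 0) := by
  cases n with
  | zero =>
    rw [rowL_zero_zero, rowL_one_zero]
    exact interlaces_one_one
  | succ n =>
    exact interlaces_of_cross_pos (leadingCoeff_rowL_pos _) (leadingCoeff_rowL_pos _)
      fun z hz => cross_rowL_rowL_succ_pos hz n

theorem hasDecomposition_rowL_succ (n : ℕ) :
    HasNonnegRealRootedInterlacingSymmetricDecomposition n (rowL (n + 1) 0) := by
  obtain ⟨a, b, h, hr, ha, hb⟩ := exists_symmetricDecomposition_rowL n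
  refine ⟨h.natDegree_le, ⟨a, b, h, ha, hb, ?_, ?_⟩, ?_⟩
  -- At a zero of `a`, both `rowL` and `rowR` take the value `z * b`.
  · refine realRooted_of_ne_zero fun z hz h0 => ?_
    have := cross_rowL_rowR_pos hz n
    rw [hr, h.1, mul_add, map_add, map_add, map_mul, map_mul, h0, mul_zero, cross_self] at this
    exact this.false
  · cases n with
    | zero => exact Or.inl (h.2.2.eq_zero (by simp))
    | succ n =>
      -- At a zero of `b`, both `rowR` and `z * rowL` take the value `z * a`.
      refine realRooted_of_ne_zero fun z hz h0 => ?_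
      have := cross_rowR_mul_rowL_pos hz n
      rw [hr, h.1, map_mul, map_add, map_add, map_mul, aeval_X, h0, mul_zero, cross_self] at this
      exact this.false
  · cases n with
    | zero =>
      rw [rowL_one_zero]
      simpa using interlaces_one_one
    | succ n =>
      have hc : ∀ z : ℂ, 0 < z.im →
          0 < cross (aeval z ((rowL (n + 2) 0).reflect (n + 1))) (aeval z (rowL (n + 2) 0)) := by
        intro z hz
        have := cross_rowR_mul_rowL_pos hz n
        rw [hr, map_mul, aeval_X, cross_mul_mul, ← h.reflect_eq] at this
        exact pos_of_mul_pos_right this (Complex.normSq_nonneg z)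
      refine interlaces_of_cross_pos ?_ (leadingCoeff_rowL_pos _) hc
      rw [h.reflect_eq] at hc ⊢
      refine (ha.add hb).leadingCoeff_pos fun h0 => ?_
      have := hc Complex.I (by simp)
      rw [h0] at this
      simp [cross] at this

-- Umbral calculus and the recurrence for the heads of the rows

/-- The linear functional on polynomials sending `X ^ n` to `h n`. -/
noncomputable def umbral {R : Type*} [CommRing R] (h : ℕ → R) : R[X] →ₗ[R] R :=
  lsum fun n => LinearMap.toSpanSingleton R R (h n)

theorem umbral_C_mul_X_pow {R : Type*} [CommRing R] (h : ℕ → R) (c : R) (n : ℕ) :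
    umbral h (C c * X ^ n) = c * h n := by
  rw [umbral, lsum_apply, C_mul_X_pow_eq_monomial,
    sum_monomial_index _ _ (LinearMap.map_zero _), LinearMap.toSpanSingleton_apply, smul_eq_mul]

theorem rowL_eq_umbral (m k : ℕ) :
    rowL (m + k) m = umbral (fun n => rowL n 0) ((X + C X) ^ m * X ^ k) := by
  induction m generalizing k with
  | zero => simpa using (umbral_C_mul_X_pow (fun n => rowL n 0) 1 k).symm
  | succ m ih =>
    have h1 : rowL (m + 1 + k) (m + 1) = rowL (m + (k + 1)) m + X * rowL (m + k) m := by
      rw [show m + 1 + k = m + k + 1 by ring, show m + (k + 1) = m + k + 1 by ring, rowL, rowL,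
        sum_range_succ _ m]
      ring
    have h2 : (X + C X) ^ (m + 1) * X ^ k = (X + C X) ^ m * X ^ (k + 1) +
        (X : ℝ[X]) • ((X + C X) ^ m * X ^ k : ℝ[X][X]) := by
      rw [smul_eq_C_mul]
      ring
    rw [h1, ih, ih, h2, map_add, map_smul, smul_eq_mul]

theorem rowR_eq_umbral (m k : ℕ) :
    rowR (m + k) m =
      umbral (fun n => rowL n 0) ((X + C X) ^ m * (X + C (X - 1)) ^ k) := by
  induction k generalizing m with
  | zero =>
    rw [add_zero, ← rowL_self]
    simpa using rowL_eq_umbral m 0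
  | succ k ih =>
    have h1 : rowR (m + (k + 1)) m = rowR (m + 1 + k) (m + 1) - rowR (m + k) m := by
      rw [show m + 1 + k = m + k + 1 by ring, show m + (k + 1) = m + k + 1 by ring, rowR, rowR,
        sum_range_succ _ m]
      ring
    rw [h1, ih, ih, ← map_sub]
    congr 1
    rw [C_sub, C_1]
    ring

/-- On monomials `t^n` with `n > 0` this is `rowR_succ_self`, since the three terms represent the
two ends and the middle of row `n`; for `n = 0` it reads `1 + 1 - 1 = 1`. -/
theorem umbral_functional_equation (g : ℝ[X][X]) :
    umbral (fun n => rowL n 0) (g + taylor (X - 1) g - taylor X g) = g.eval 0 := by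
  suffices h : umbral (fun n => rowL n 0) ∘ₗ (LinearMap.id + taylor (X - 1) - taylor X) =
      leval 0 by simpa using LinearMap.congr_fun h g
  refine lhom_ext' fun n => LinearMap.ext_ring ?_
  simp only [LinearMap.comp_apply, LinearMap.sub_apply, LinearMap.add_apply, LinearMap.id_apply,
    taylor_monomial, C_1, one_mul, leval_apply, eval_monomial]
  rw [map_sub, map_add]
  have h0 := rowL_eq_umbral 0 n
  have h1 := rowR_eq_umbral 0 n
  have h2 := rowL_eq_umbral n 0
  simp only [pow_zero, one_mul, mul_one, zero_add, add_zero] at h0 h1 h2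
  rw [← h1, ← h2, monomial_one_right_eq_X_pow, ← h0]
  cases n with
  | zero => simp [rowL, rowR]
  | succ n => rw [rowL_self, rowR_succ_self]; simp

theorem umbral_X_add_C_pow {R : Type*} [CommRing R] (h : ℕ → R) (c : R) (n : ℕ) :
    umbral h ((X + C c) ^ n) = ∑ k ∈ range (n + 1), n.choose k • (h k * c ^ (n - k)) := by
  rw [add_pow, map_sum]
  refine sum_congr rfl fun k _ => ?_
  rw [← C_pow, ← C_eq_natCast, mul_assoc, ← C_mul, mul_comm, umbral_C_mul_X_pow, nsmul_eq_mul]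
  ring

theorem rowL_recurrence (n : ℕ) : rowL n 0 = (1 - X) ^ n +
    ∑ k ∈ range (n + 1), n.choose k • (rowL k 0 * (1 - (1 - X) ^ (n - k))) := by
  -- With `g = (t + 1 - x)^n` the two shifts become `t^n` and `(t + 1)^n`.
  have h := umbral_functional_equation (taylor (1 - X) (X ^ n))
  rw [taylor_taylor, taylor_taylor, show (X - 1 + (1 - X) : ℝ[X]) = 0 by ring,
    show (X + (1 - X) : ℝ[X]) = 1 by ring, taylor_zero, taylor_X_pow, taylor_X_pow, map_sub,
    map_add, umbral_X_add_C_pow, umbral_X_add_C_pow] at h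
  have h1 := umbral_C_mul_X_pow (fun n => rowL n 0) 1 n
  rw [C_1, one_mul, one_mul] at h1
  rw [h1, eval_pow, eval_add, eval_X, eval_C, zero_add] at h
  rw [← h]
  simp only [mul_sub, smul_sub, sum_sub_distrib, one_pow]
  ring

end Antiprism
-- Face enumeration of the antiprism triangulation
namespace Antiprism
open Polynomial Finset

/-- Two pointed sets span an edge of the antiprism triangulation, or are equal. -/
def PointedAdj {V : Type*} (p q : Finset V × V) : Prop :=
  p.1 = q.1 ∨ (p.1 ⊂ q.1 ∧ q.2 ∉ p.1) ∨ (q.1 ⊂ p.1 ∧ p.2 ∉ q.1)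

theorem PointedAdj.symm {V : Type*} {p q : Finset V × V} (h : PointedAdj p q) : PointedAdj q p :=
  h.elim (fun h => Or.inl h.symm) fun h => Or.inr h.symm

variable {V : Type*} [DecidableEq V]

open Classical in
/-- The faces of the antiprism triangulation of the simplex on the vertex set `K`. -/
noncomputable def pointedCliques (K : Finset V) : Finset (Finset (Finset V × V)) :=
  (K.powerset ×ˢ K).powerset.filter fun S =>
    (∀ p ∈ S, p.2 ∈ p.1) ∧ ∀ p ∈ S, ∀ q ∈ S, PointedAdj p q

theorem mem_pointedCliques {K : Finset V} {S : Finset (Finset V × V)} :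
    S ∈ pointedCliques K ↔
      (∀ p ∈ S, p.1 ⊆ K ∧ p.2 ∈ p.1) ∧ ∀ p ∈ S, ∀ q ∈ S, PointedAdj p q := by
  refine (@mem_filter _ _ (_) _ _).trans ?_
  rw [mem_powerset, ← and_assoc]
  refine and_congr_left fun _ => ⟨fun h p hp => ⟨?_, h.2 p hp⟩,
    fun h => ⟨fun p hp => ?_, fun p hp => (h p hp).2⟩⟩
  · exact mem_powerset.1 (mem_product.1 (h.1 hp)).1
  · exact mem_product.2 ⟨mem_powerset.2 (h p hp).1, (h p hp).1 (h p hp).2⟩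

theorem empty_mem_pointedCliques (K : Finset V) : ∅ ∈ pointedCliques K := by
  simp [mem_pointedCliques]

/-- Adjacency forces distinct members of a clique to have distinct marked points. -/
theorem card_le_of_mem_pointedCliques {K : Finset V} {S : Finset (Finset V × V)}
    (h : S ∈ pointedCliques K) : S.card ≤ K.card := by
  rw [mem_pointedCliques] at h
  refine card_le_card_of_injOn Prod.snd (fun p hp => (h.1 p hp).1 (h.1 p hp).2) ?_
  intro p hp q hq hpq
  rcases h.2 p hp q hq with h1 | h1 | h1
  · exact Prod.ext h1 hpq
  · exact absurd (hpq ▸ (h.1 p hp).2) h1.2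
  · exact absurd (hpq ▸ (h.1 q hq).2) h1.2

/-- Add to a set of pointed sets inside `K` the pointed sets `(K ∪ U, u)` for `u ∈ U`. -/
def addTop (K U : Finset V) (S : Finset (Finset V × V)) : Finset (Finset V × V) :=
  S ∪ U.image fun u => (K ∪ U, u)

theorem mem_addTop {K U : Finset V} {S : Finset (Finset V × V)} {p : Finset V × V} :
    p ∈ addTop K U S ↔ p ∈ S ∨ p.1 = K ∪ U ∧ p.2 ∈ U := by
  rw [addTop, mem_union, mem_image]
  refine or_congr_right ⟨?_, fun h => ⟨p.2, h.2, by rw [← h.1]⟩⟩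
  rintro ⟨u, hu, rfl⟩
  exact ⟨rfl, hu⟩

section addTop

variable {K K' U : Finset V} {S : Finset (Finset V × V)}

theorem ne_of_mem_pointedCliques (hU : U.Nonempty) (hd : Disjoint K U) (hS : S ∈ pointedCliques K)
    {p : Finset V × V} (hp : p ∈ S) : p.1 ≠ K ∪ U := by
  intro h
  obtain ⟨u, hu⟩ := hU
  have := ((mem_pointedCliques.1 hS).1 p hp).1
  rw [h] at this
  exact disjoint_left.1 hd (this (mem_union_right _ hu)) hu

theorem addTop_mem (hU : U.Nonempty) (hd : Disjoint K U) (hK : K ⊆ K') (hUK : U ⊆ K')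
    (hS : S ∈ pointedCliques K) : addTop K U S ∈ pointedCliques K' := by
  have hne := fun p => ne_of_mem_pointedCliques hU hd hS (p := p)
  rw [mem_pointedCliques] at hS ⊢
  have hadj : ∀ p ∈ S, ∀ q : Finset V × V, q.1 = K ∪ U → q.2 ∈ U → PointedAdj p q :=
    fun p hp q hq hu => Or.inr (Or.inl ⟨lt_of_le_of_ne
      (hq ▸ (hS.1 p hp).1.trans subset_union_left) (hq ▸ hne p hp),
      fun h => disjoint_left.1 hd ((hS.1 p hp).1 h) hu⟩)
  refine ⟨fun p hp => ?_, fun p hp q hq => ?_⟩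
  · rcases mem_addTop.1 hp with hp | hp
    · exact ⟨(hS.1 p hp).1.trans hK, (hS.1 p hp).2⟩
    · rw [hp.1]
      exact ⟨union_subset hK hUK, mem_union_right _ hp.2⟩
  · rcases mem_addTop.1 hp with hp | hp <;> rcases mem_addTop.1 hq with hq | hq
    · exact hS.2 p hp q hq
    · exact hadj p hp q hq.1 hq.2
    · exact (hadj q hq p hp.1 hp.2).symm
    · exact Or.inl (hp.1.trans hq.1.symm)

theorem card_addTop (hU : U.Nonempty) (hd : Disjoint K U) (hS : S ∈ pointedCliques K) :
    (addTop K U S).card = U.card + S.card := by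
  rw [addTop, card_union_of_disjoint, card_image_of_injective, add_comm]
  · exact fun u v h => congrArg Prod.snd h
  · refine disjoint_left.2 fun p hp h => ne_of_mem_pointedCliques hU hd hS hp ?_
    obtain ⟨u, -, rfl⟩ := mem_image.1 h
    rfl

theorem sup_addTop (hU : U.Nonempty) (hS : S ∈ pointedCliques K) :
    (addTop K U S).sup Prod.fst = K ∪ U := by
  refine le_antisymm (Finset.sup_le fun p hp => ?_) ?_
  · rcases mem_addTop.1 hp with hp | hp
    · exact ((mem_pointedCliques.1 hS).1 p hp).1.trans subset_union_left
    · exact hp.1.le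
  · obtain ⟨u, hu⟩ := hU
    exact le_sup (f := Prod.fst) (mem_addTop.2 (Or.inr ⟨rfl, hu⟩) : (K ∪ U, u) ∈ addTop K U S)

theorem image_filter_addTop (hU : U.Nonempty) (hd : Disjoint K U) (hS : S ∈ pointedCliques K) :
    ((addTop K U S).filter fun p => p.1 = K ∪ U).image Prod.snd = U := by
  ext u
  simp only [mem_image, mem_filter, mem_addTop]
  constructor
  · rintro ⟨p, ⟨hp | hp, h⟩, rfl⟩
    · exact absurd h (ne_of_mem_pointedCliques hU hd hS hp)
    · exact hp.2
  · exact fun hu => ⟨(K ∪ U, u), ⟨Or.inr ⟨rfl, hu⟩, rfl⟩, rfl⟩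

theorem filter_ne_addTop (hU : U.Nonempty) (hd : Disjoint K U) (hS : S ∈ pointedCliques K) :
    ((addTop K U S).filter fun p => p.1 ≠ K ∪ U) = S := by
  ext p
  simp only [mem_filter, mem_addTop]
  constructor
  · rintro ⟨hp | hp, h⟩
    · exact hp
    · exact absurd hp.1 h
  · exact fun hp => ⟨Or.inl hp, ne_of_mem_pointedCliques hU hd hS hp⟩

/-- Take `T` a largest set in the clique and `U` the points marked in `T`. Every other member is a
proper subset of `T` avoiding `U`, so the rest is a clique inside `T \ U`. -/
theorem exists_eq_addTop (hS : S ∈ pointedCliques K) (hne : S.Nonempty) :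
    ∃ K' U S', K' ⊆ K ∧ U ⊆ K ∧ U.Nonempty ∧ Disjoint K' U ∧ S' ∈ pointedCliques K' ∧
      addTop K' U S' = S := by
  obtain ⟨t, ht, hmax⟩ := exists_max_image S (fun p => p.1.card) hne
  rw [mem_pointedCliques] at hS
  set U := (S.filter fun p => p.1 = t.1).image Prod.snd with hU
  have hmem : ∀ u, u ∈ U ↔ (t.1, u) ∈ S := by
    intro u
    simp only [hU, mem_image, mem_filter]
    constructor
    · rintro ⟨p, ⟨hp, h⟩, rfl⟩
      rwa [← h]
    · exact fun h => ⟨_, ⟨h, rfl⟩, rfl⟩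
  have hsub : U ⊆ t.1 := fun u hu => (hS.1 _ ((hmem u).1 hu)).2
  have hun : t.1 \ U ∪ U = t.1 := sdiff_union_of_subset hsub
  refine ⟨t.1 \ U, U, S.filter fun p => p.1 ≠ t.1, sdiff_subset.trans (hS.1 t ht).1,
    hsub.trans (hS.1 t ht).1, ⟨t.2, (hmem _).2 ht⟩, sdiff_disjoint, ?_, ?_⟩
  · rw [mem_pointedCliques]
    refine ⟨fun p hp => ⟨?_, (hS.1 p (mem_filter.1 hp).1).2⟩, fun p hp q hq =>
      hS.2 p (mem_filter.1 hp).1 q (mem_filter.1 hq).1⟩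
    obtain ⟨hp, hpt⟩ := mem_filter.1 hp
    have key : ∀ u, (t.1, u) ∈ S → p.1 ⊂ t.1 ∧ u ∉ p.1 := by
      intro u hu
      rcases hS.2 p hp _ hu with h | h | h
      · exact absurd h hpt
      · exact h
      · exact absurd (hmax p hp) (card_lt_card h.1).not_ge
    exact subset_sdiff.2 ⟨(key t.2 ht).1.subset,
      disjoint_right.2 fun u hu => (key u ((hmem u).1 hu)).2⟩
  · ext p
    rw [mem_addTop, hun, mem_filter, hmem]
    constructor
    · rintro (h | ⟨h1, h2⟩)
      · exact h.1
      · rwa [← h1] at h2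
    · intro h
      by_cases hp : p.1 = t.1
      · exact Or.inr ⟨hp, by rwa [← hp]⟩
      · exact Or.inl ⟨h, hp⟩

end addTop

/-- The face enumerator `∑_S x^|S| y^(|K| - |S|)` of the antiprism triangulation of the simplex on
the vertex set `K`. -/
noncomputable def cliqueSum {R : Type*} [CommRing R] (x y : R) (K : Finset V) : R :=
  ∑ S ∈ pointedCliques K, x ^ S.card * y ^ (K.card - S.card)

/-- A nonempty clique is uniquely a clique on some `L` together with a nonempty set `U ⊆ K \ L` of
points marked in `L ∪ U`; the binomial theorem sums over `U`, and the subtracted power removes `U =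
∅`. -/
theorem cliqueSum_recurrence {R : Type*} [CommRing R] (x y : R) (K : Finset V) :
    cliqueSum x y K = y ^ K.card + ∑ L ∈ K.powerset,
      cliqueSum x y L * ((x + y) ^ (K.card - L.card) - y ^ (K.card - L.card)) := by
  have hpow : ∀ L ∈ K.powerset, (x + y) ^ (K.card - L.card) - y ^ (K.card - L.card) =
      ∑ U ∈ (K \ L).powerset.erase ∅, x ^ U.card * y ^ (K.card - L.card - U.card) := by
    intro L hL
    rw [← card_sdiff_of_subset (mem_powerset.1 hL), ← sum_pow_mul_eq_add_pow,
      ← add_sum_erase _ _ (empty_mem_powerset (K \ L))]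
    simp
  rw [cliqueSum, ← add_sum_erase _ _ (empty_mem_pointedCliques K)]
  simp only [card_empty, pow_zero, one_mul, Nat.sub_zero]
  congr 1
  have hsum : ∑ L ∈ K.powerset,
      cliqueSum x y L * ((x + y) ^ (K.card - L.card) - y ^ (K.card - L.card)) =
      ∑ L ∈ K.powerset, ∑ P ∈ pointedCliques L ×ˢ (K \ L).powerset.erase ∅,
        x ^ (addTop L P.2 P.1).card * y ^ (K.card - (addTop L P.2 P.1).card) := by
    refine sum_congr rfl fun L hL => ?_
    rw [hpow L hL, cliqueSum, sum_mul_sum, ← sum_product']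
    refine sum_congr rfl fun P hP => ?_
    rw [mem_product, mem_erase, mem_powerset] at hP
    have hU := subset_sdiff.1 hP.2.2
    rw [card_addTop (nonempty_iff_ne_empty.2 hP.2.1) hU.2.symm hP.1]
    have h1 := card_le_of_mem_pointedCliques hP.1
    have h2 := card_le_card hP.2.2
    rw [card_sdiff_of_subset (mem_powerset.1 hL)] at h2
    have h3 := card_le_card (mem_powerset.1 hL)
    rw [show K.card - (P.2.card + P.1.card) =
      (L.card - P.1.card) + (K.card - L.card - P.2.card) by omega]
    ring
  rw [hsum, sum_sigma']
  have hmem : ∀ {a : Σ _ : Finset V, Finset (Finset V × V) × Finset V},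
      a ∈ K.powerset.sigma (fun L => pointedCliques L ×ˢ (K \ L).powerset.erase ∅) →
      a.1 ⊆ K ∧ a.2.2 ⊆ K ∧ a.2.2.Nonempty ∧ Disjoint a.1 a.2.2 ∧
        a.2.1 ∈ pointedCliques a.1 := by
    intro a ha
    rw [mem_sigma, mem_product, mem_erase, mem_powerset, mem_powerset] at ha
    have hU := subset_sdiff.1 ha.2.2.2
    exact ⟨ha.1, hU.1, nonempty_iff_ne_empty.2 ha.2.2.1, hU.2.symm, ha.2.1⟩
  symm
  refine sum_bij (fun a _ => addTop a.1 a.2.2 a.2.1) ?_ ?_ ?_ fun _ _ => rfl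
  · intro a ha
    obtain ⟨h1, h2, h3, h4, h5⟩ := hmem ha
    refine mem_erase.2 ⟨?_, addTop_mem h3 h4 h1 h2 h5⟩
    rw [← nonempty_iff_ne_empty, ← card_pos, card_addTop h3 h4 h5]
    have := h3.card_pos
    omega
  · rintro ⟨L, S, U⟩ ha ⟨L', S', U'⟩ ha' heq
    obtain ⟨-, -, h3, h4, h5⟩ := hmem ha
    obtain ⟨-, -, h3', h4', h5'⟩ := hmem ha'
    dsimp only at *
    -- The top set is the union of all sets in the clique; it determines `U`, then the remaining
    -- clique, and finally `L` as its difference with `U`.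
    have hT : L ∪ U = L' ∪ U' := by rw [← sup_addTop h3 h5, heq, sup_addTop h3' h5']
    have hU : U = U' := by
      rw [← image_filter_addTop h3 h4 h5, heq, hT, image_filter_addTop h3' h4' h5']
    have hS : S = S' := by
      rw [← filter_ne_addTop h3 h4 h5, heq, hT, filter_ne_addTop h3' h4' h5']
    subst hU hS
    have hL : L = L' := by
      rw [← union_sdiff_cancel_right h4, hT, union_sdiff_cancel_right h4']
    rw [hL]
  · intro S hS
    rw [mem_erase, ← nonempty_iff_ne_empty] at hS
    obtain ⟨L, U, S', h1, h2, h3, h4, h5, h6⟩ := exists_eq_addTop hS.2 hS.1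
    refine ⟨⟨L, S', U⟩, ?_, h6⟩
    rw [mem_sigma, mem_product, mem_erase, mem_powerset, mem_powerset]
    exact ⟨h1, h5, h3.ne_empty, subset_sdiff.2 ⟨h2, h4.symm⟩⟩

theorem cliqueSum_eq_rowL (K : Finset V) : cliqueSum X (1 - X) K = rowL K.card 0 := by
  induction K using Finset.strongInduction with
  | H K ih =>
    rw [cliqueSum_recurrence, rowL_recurrence, add_sub_cancel]
    simp only [one_pow]
    congr 1
    rw [← sum_powerset_apply_card
      (fun k => rowL k 0 * (1 - (1 - X) ^ (K.card - k))) (x := K)]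
    refine sum_congr rfl fun L hL => ?_
    -- The term `L = K` has factor `0`, so only proper subsets enter and the recurrence determines
    -- the enumerator.
    rcases (mem_powerset.1 hL).eq_or_ssubset with rfl | h
    · simp
    · rw [ih L h]

theorem mem_allFaces_antiprismTriangulation {n : ℕ}
    {F : Finset (PointedFace (simplex n))} :
    F ∈ allFaces (antiprismTriangulation (simplex n)) ↔
      F.map (Function.Embedding.subtype _) ∈ pointedCliques (univ : Finset (Fin n)) := by
  refine (@mem_filter _ _ (_) _ _).trans ?_
  rw [mem_pointedCliques]
  simp only [mem_univ, true_and, mem_map, Function.Embedding.subtype_apply, subset_univ]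
  have hF : (F = ∅ ∨ F ∈ (antiprismTriangulation (simplex n)).faces) ↔
      (pointedFaceGraph (simplex n)).IsClique (F : Set _) := by
    rcases F.eq_empty_or_nonempty with rfl | hne
    · simp
    · simp only [hne.ne_empty, false_or]
      exact and_iff_right hne
  rw [hF]
  constructor
  · refine fun h => ⟨?_, ?_⟩
    · rintro _ ⟨p, -, rfl⟩
      exact p.2.2
    · rintro _ ⟨p, hp, rfl⟩ _ ⟨q, hq, rfl⟩
      by_cases hpq : p = q
      · exact Or.inl (by rw [hpq])
      · exact (h hp hq hpq).2
  · exact fun h p hp q hq hpq => ⟨hpq, h.2 _ ⟨p, hp, rfl⟩ _ ⟨q, hq, rfl⟩⟩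

theorem rank_antiprismTriangulation (n : ℕ) :
    rank (antiprismTriangulation (simplex n)) = n := by
  refine le_antisymm (Finset.sup_le fun F hF => ?_) ?_
  · have := card_le_of_mem_pointedCliques (mem_allFaces_antiprismTriangulation.1 hF)
    simpa using this
  -- The pointed faces on the full vertex set form a clique of size `n`.
  · let f : Fin n → PointedFace (simplex n) := fun v =>
      ⟨(univ, v), ⟨v, mem_univ v⟩, mem_univ v⟩
    have hf : Function.Injective f := fun u v h => congrArg (fun p => p.1.2) h
    have hmem : univ.map ⟨f, hf⟩ ∈ allFaces (antiprismTriangulation (simplex n)) := by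
      rw [mem_allFaces_antiprismTriangulation, mem_pointedCliques]
      simp only [mem_map, mem_univ, true_and, Function.Embedding.subtype_apply,
        Function.Embedding.coeFn_mk]
      refine ⟨?_, ?_⟩
      · rintro _ ⟨_, ⟨v, rfl⟩, rfl⟩
        exact ⟨subset_rfl, mem_univ v⟩
      · rintro _ ⟨_, ⟨u, rfl⟩, rfl⟩ _ ⟨_, ⟨v, rfl⟩, rfl⟩
        exact Or.inl rfl
    have := le_sup (f := Finset.card) hmem
    rwa [card_map, card_univ, Fintype.card_fin] at this

theorem hA_eq_rowL (n : ℕ) : hA n = rowL n 0 := by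
  classical
  have h := cliqueSum_eq_rowL (univ : Finset (Fin n))
  rw [card_univ, Fintype.card_fin] at h
  rw [← h, hA, hPoly, rank_antiprismTriangulation, cliqueSum, card_univ, Fintype.card_fin]
  refine sum_bij (fun F _ => F.map (Function.Embedding.subtype _))
    (fun F hF => mem_allFaces_antiprismTriangulation.1 hF)
    (fun F _ F' _ h => map_injective _ h) (fun S hS => ?_) fun F _ => by rw [card_map]
  have hsub : ∀ p ∈ S, p.1 ∈ (simplex n).faces ∧ p.2 ∈ p.1 := fun p hp =>
    have := (mem_pointedCliques.1 hS).1 p hp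
    ⟨⟨p.2, this.2⟩, this.2⟩
  have hmap := subtype_map_of_mem hsub
  exact ⟨S.subtype _, mem_allFaces_antiprismTriangulation.2 (by rwa [hmap]), hmap⟩

end Antiprism

theorem mainTheorem1 :
    (∀ n : ℕ, Antiprism.RealRooted (Antiprism.hA n) ∧
      Antiprism.Interlaces (Antiprism.hA n) (Antiprism.hA (n + 1))) ∧
    (∀ n : ℕ, 1 ≤ n →
      Antiprism.HasNonnegRealRootedInterlacingSymmetricDecomposition (n - 1) (Antiprism.hA n)) := by
  refine ⟨fun n => ?_, fun n hn => ?_⟩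
  · rw [Antiprism.hA_eq_rowL, Antiprism.hA_eq_rowL]
    have h := Antiprism.interlaces_rowL_succ n
    exact ⟨h.1, h⟩
  · obtain ⟨m, rfl⟩ := Nat.exists_eq_add_of_le' hn
    rw [Antiprism.hA_eq_rowL, Nat.add_sub_cancel]
    exact Antiprism.hasDecomposition_rowL_succ m
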